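/- Let $k$ be a field and let $q\in k$ be a nonzero element of infinite multiplicative order (that is, $q^n\neq 1$ for all $n\geq 1$). Let $$\Lambda=\Lambda(q)=k\langle x,y,z\rangle/(x^{2},\,y^{2},\,z^{2},\,zy,\,yx+qxy,\,zx-xz,\,yz-xz),$$ and let $M(q)$ be the three-dimensional right $\Lambda$-module with basis $v,v',v''$, where $vx=qv'$, $vy=v'$, $vz=v''$, and $v',v''$ are annihilated by $x$, $y$ and $z$. Let $$B=\Lambda[M(q)]=\begin{pmatrix}k&M(q)\\0&\Lambda\end{pmatrix}$$ be the one-point extension algebra. Then $B$ is a finite-dimensional $k$-algebra with infinite delooping level, $\operatorname{dell}B=\infty$. Here, for a finite-dimensional algebra $A$ and a finitely generated right $A$-module $M$, the delooping level $\operatorname{dell}M$ is the smallest integer $n\geq 0$ such that $\Omega^{n}M$ is a direct summand, in the stable category of finitely generated right $A$-modules, of $\Omega^{n+1}N$ for some finitely generated right $A$-module $N$ (and $\operatorname{dell}M=\infty$ if there is no such $n$), where $\Omega$ denotes the syzygy; and $\operatorname{dell}A$ is the largest delooping level of a simple right $A$-module. -/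

import Mathlib

universe u

open MulOpposite

/-! ## Syzygies, the stable module category and the delooping level

For a ring `R`, "module" means left `R`-module. Right modules over an algebra `A` are modules over
`Aᵐᵒᵖ`, as usual in Mathlib. -/

section Delooping

variable (R : Type u) [Ring R]

/-- A linear map that factors through a finitely generated projective module, i.e. a map that is
zero in the stable category of finitely generated modules. -/
def StablyZero {X Y : Type u} [AddCommGroup X] [Module R X] [AddCommGroup Y] [Module R Y]
    (f : X →ₗ[R] Y) : Prop :=
  ∃ (P : Type u) (_ : AddCommGroup P) (_ : Module R P) (g : X →ₗ[R] P) (h : P →ₗ[R] Y),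
    Module.Finite R P ∧ Module.Projective R P ∧ f = h ∘ₗ g

/-- `X` and `Y` are isomorphic in the stable module category. -/
def StablyIso (X Y : Type u) [AddCommGroup X] [Module R X] [AddCommGroup Y] [Module R Y] : Prop :=
  ∃ (f : X →ₗ[R] Y) (g : Y →ₗ[R] X),
    StablyZero R (g ∘ₗ f - LinearMap.id) ∧ StablyZero R (f ∘ₗ g - LinearMap.id)

/-- `X` is a direct summand of `Y` in the stable category of finitely generated modules. -/
def IsStableSummand (X Y : Type u) [AddCommGroup X] [Module R X] [AddCommGroup Y] [Module R Y] :
    Prop :=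
  ∃ (Z : Type u) (_ : AddCommGroup Z) (_ : Module R Z), Module.Finite R Z ∧ StablyIso R (X × Z) Y

/-- `K` is a syzygy `Ω M` of `M`: there is a short exact sequence `0 → K → P → M → 0` with `P`
finitely generated projective. This determines `K` up to isomorphism in the stable category. -/
def IsSyzygy (M K : Type u) [AddCommGroup M] [Module R M] [AddCommGroup K] [Module R K] : Prop :=
  ∃ (P : Type u) (_ : AddCommGroup P) (_ : Module R P) (i : K →ₗ[R] P) (p : P →ₗ[R] M),
    Module.Finite R P ∧ Module.Projective R P ∧
      Function.Injective i ∧ Function.Exact i p ∧ Function.Surjective p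

/-- `K` is an `n`-th syzygy `Ωⁿ M` of `M`. -/
def IsNthSyzygy : ℕ → ∀ (M K : Type u) [AddCommGroup M] [Module R M] [AddCommGroup K] [Module R K],
    Prop
  | 0, M, K, _, _, _, _ => Nonempty (K ≃ₗ[R] M)
  | n + 1, M, K, _, _, _, _ =>
    ∃ (L : Type u) (_ : AddCommGroup L) (_ : Module R L), IsSyzygy R M L ∧ IsNthSyzygy n L K

/-- `Ωⁿ M` is a direct summand, in the stable module category, of `Ωⁿ⁺¹ N` for some finitely
generated module `N`. -/
def IsDeloopedAt (n : ℕ) (M : Type u) [AddCommGroup M] [Module R M] : Prop :=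
  ∃ (K : Type u) (_ : AddCommGroup K) (_ : Module R K)
    (N : Type u) (_ : AddCommGroup N) (_ : Module R N)
    (L : Type u) (_ : AddCommGroup L) (_ : Module R L),
    IsNthSyzygy R n M K ∧ Module.Finite R N ∧ IsNthSyzygy R (n + 1) N L ∧ IsStableSummand R K L

/-- The delooping level of a module: the smallest `n` such that `Ωⁿ M` is a stable direct summand
of some `Ωⁿ⁺¹ N`, and `⊤` if there is no such `n`. -/
noncomputable def moduleDell (M : Type u) [AddCommGroup M] [Module R M] : ℕ∞ :=
  ⨅ (n : ℕ) (_ : IsDeloopedAt R n M), (n : ℕ∞)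

/-- The delooping level of a finite-dimensional algebra `A`: the largest delooping level of a simple
right `A`-module. -/
noncomputable def dell (A : Type u) [Ring A] : ℕ∞ :=
  ⨆ (S : ModuleCat.{u} Aᵐᵒᵖ) (_ : IsSimpleModule Aᵐᵒᵖ S), moduleDell Aᵐᵒᵖ S

end Delooping

/-! ## One-point extensions -/

section OnePoint

/-- The one-point extension `A[M]`, the algebra of matrices `(c, m; 0, a)` with `c ∈ k`, `m ∈ M`,
`a ∈ A`, for a right `A`-module `M`. -/
@[ext]
structure OnePointExtension (k A M : Type u) : Type u where
  /-- The upper left entry. -/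
  scalar : k
  /-- The upper right entry. -/
  vec : M
  /-- The lower right entry. -/
  alg : A

namespace OnePointExtension

/-- A matrix as the triple of its entries. -/
def equivProd (k A M : Type u) : OnePointExtension k A M ≃ k × M × A where
  toFun s := (s.scalar, s.vec, s.alg)
  invFun t := ⟨t.1, t.2.1, t.2.2⟩
  left_inv _ := rfl
  right_inv _ := rfl

section Operations

variable {k A M : Type u} [Field k] [Ring A] [AddCommGroup M]

/-- Entrywise addition. -/
instance : AddCommGroup (OnePointExtension k A M) := (equivProd k A M).addCommGroup

instance : One (OnePointExtension k A M) := ⟨⟨1, 0, 1⟩⟩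

@[simp] theorem zero_scalar : (0 : OnePointExtension k A M).scalar = 0 := rfl
@[simp] theorem zero_vec : (0 : OnePointExtension k A M).vec = 0 := rfl
@[simp] theorem zero_alg : (0 : OnePointExtension k A M).alg = 0 := rfl
@[simp] theorem one_scalar : (1 : OnePointExtension k A M).scalar = 1 := rfl
@[simp] theorem one_vec : (1 : OnePointExtension k A M).vec = 0 := rfl
@[simp] theorem one_alg : (1 : OnePointExtension k A M).alg = 1 := rfl
@[simp] theorem add_scalar (s t : OnePointExtension k A M) :
    (s + t).scalar = s.scalar + t.scalar := rfl
@[simp] theorem add_vec (s t : OnePointExtension k A M) :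
    (s + t).vec = s.vec + t.vec := rfl
@[simp] theorem add_alg (s t : OnePointExtension k A M) :
    (s + t).alg = s.alg + t.alg := rfl

section Scalar

variable [Algebra k A] [Module k M]

/-- Entrywise scalar multiplication. -/
instance : Module k (OnePointExtension k A M) := (equivProd k A M).module k

@[simp] theorem smul_scalar (r : k) (s : OnePointExtension k A M) :
    (r • s).scalar = r • s.scalar := rfl
@[simp] theorem smul_vec (r : k) (s : OnePointExtension k A M) :
    (r • s).vec = r • s.vec := rfl
@[simp] theorem smul_alg (r : k) (s : OnePointExtension k A M) :
    (r • s).alg = r • s.alg := rfl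

end Scalar

variable [Module k M] [Module Aᵐᵒᵖ M]

/-- Matrix multiplication: `(c, m; 0, a) (c', m'; 0, a') = (c c', c m' + m a'; 0, a a')`. -/
instance : Mul (OnePointExtension k A M) :=
  ⟨fun s t => ⟨s.scalar * t.scalar, s.scalar • t.vec + op t.alg • s.vec, s.alg * t.alg⟩⟩

@[simp] theorem mul_scalar (s t : OnePointExtension k A M) :
    (s * t).scalar = s.scalar * t.scalar := rfl
@[simp] theorem mul_vec (s t : OnePointExtension k A M) :
    (s * t).vec = s.scalar • t.vec + op t.alg • s.vec := rfl
@[simp] theorem mul_alg (s t : OnePointExtension k A M) :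
    (s * t).alg = s.alg * t.alg := rfl

end Operations

variable {k A M : Type u} [Field k] [Ring A] [Algebra k A] [AddCommGroup M] [Module k M]
  [Module Aᵐᵒᵖ M] [IsScalarTower k Aᵐᵒᵖ M]

instance : Ring (OnePointExtension k A M) :=
  { (inferInstance : AddCommGroup (OnePointExtension k A M)),
    (inferInstance : Mul (OnePointExtension k A M)),
    (inferInstance : One (OnePointExtension k A M)) with
    left_distrib := fun a b c => by
      ext
      · simp [mul_add]
      · simp only [mul_vec, add_vec, add_alg, smul_add, op_add, add_smul]
        exact add_add_add_comm _ _ _ _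
      · simp [mul_add]
    right_distrib := fun a b c => by
      ext
      · simp [add_mul]
      · simp only [mul_vec, add_vec, add_scalar, smul_add, add_smul]
        exact add_add_add_comm _ _ _ _
      · simp [add_mul]
    zero_mul := fun a => by ext <;> simp
    mul_zero := fun a => by ext <;> simp
    mul_assoc := fun a b c => by
      have : SMulCommClass k Aᵐᵒᵖ M := IsScalarTower.to_smulCommClass
      ext
      · simp [mul_assoc]
      · simp only [mul_vec, mul_scalar, mul_alg, smul_add, op_mul, mul_smul, add_assoc]
        rw [smul_comm (op c.alg) a.scalar b.vec]
      · simp [mul_assoc]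
    one_mul := fun a => by ext <;> simp
    mul_one := fun a => by ext <;> simp }

/-- The scalar `c ∈ k` acts as the matrix `(c, 0; 0, c)`. -/
instance : Algebra k (OnePointExtension k A M) :=
  Algebra.ofModule
    (fun r s t => by
      have : SMulCommClass k Aᵐᵒᵖ M := IsScalarTower.to_smulCommClass
      ext
      · simp [mul_assoc]
      · simp only [mul_vec, smul_vec, smul_scalar, smul_add, smul_assoc]
        rw [smul_comm (op t.alg) r s.vec]
      · simp)
    (fun r s t => by
      ext
      · simp [mul_left_comm]
      · simp only [mul_vec, smul_vec, smul_alg, smul_add, op_smul, smul_assoc]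
        rw [smul_comm s.scalar r t.vec]
      · simp)

end OnePointExtension

end OnePoint

/-! ## The algebra `Λ(q)` and the modules `M(α)` -/

section RingelZhang

/-- The three generators of `Λ(q)`. -/
inductive RZGen : Type
  | x
  | y
  | z

variable {k : Type u} [Field k]

open FreeAlgebra in
/-- The defining relations
`x² = y² = z² = zy = yx + q xy = zx - xz = yz - xz = 0` of `Λ(q)`. -/
inductive RZRel (q : k) : FreeAlgebra k RZGen → FreeAlgebra k RZGen → Prop
  | xx : RZRel q (ι k RZGen.x * ι k RZGen.x) 0
  | yy : RZRel q (ι k RZGen.y * ι k RZGen.y) 0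
  | zz : RZRel q (ι k RZGen.z * ι k RZGen.z) 0
  | zy : RZRel q (ι k RZGen.z * ι k RZGen.y) 0
  | yx : RZRel q (ι k RZGen.y * ι k RZGen.x + q • (ι k RZGen.x * ι k RZGen.y)) 0
  | zx : RZRel q (ι k RZGen.z * ι k RZGen.x - ι k RZGen.x * ι k RZGen.z) 0
  | yz : RZRel q (ι k RZGen.y * ι k RZGen.z - ι k RZGen.x * ι k RZGen.z) 0

/-- The algebra `Λ(q) = k⟨x, y, z⟩ / (x², y², z², zy, yx + q xy, zx - xz, yz - xz)`. -/
abbrev RZAlgebra (q : k) : Type u := RingQuot (RZRel q)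

/-- The matrices of right multiplication by the generators on `M(α)`, with respect to the basis
`v, v', v''` and acting on row vectors: `vx = α v'`, `vy = v'`, `vz = v''`, and
`v'`, `v''` are annihilated by `x`, `y`, `z`. -/
def rzMatrix (α : k) : RZGen → Matrix (Fin 3) (Fin 3) k
  | RZGen.x => !![0, α, 0; 0, 0, 0; 0, 0, 0]
  | RZGen.y => !![0, 1, 0; 0, 0, 0; 0, 0, 0]
  | RZGen.z => !![0, 0, 1; 0, 0, 0; 0, 0, 0]

theorem rzMatrix_mul (α : k) (g h : RZGen) : rzMatrix α g * rzMatrix α h = 0 := by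
  cases g <;> cases h <;> ext i j <;> fin_cases i <;> fin_cases j <;>
    simp [rzMatrix, Matrix.mul_apply, Fin.sum_univ_three]

/-- The matrix representation of `Λ(q)` on row vectors that defines `M(α)`. -/
noncomputable def rzRep (q α : k) : RZAlgebra q →ₐ[k] Matrix (Fin 3) (Fin 3) k :=
  RingQuot.liftAlgHom k ⟨FreeAlgebra.lift k (rzMatrix α), by
    intro a b h
    cases h <;> simp [rzMatrix_mul]⟩

/-- The three-dimensional right `Λ(q)`-module `M(α)`, with basis `v, v', v''` the standard basis
of `k³`. -/
def RZModule (_q _α : k) : Type u := Fin 3 → k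

variable (q α : k)

instance : AddCommGroup (RZModule q α) := inferInstanceAs (AddCommGroup (Fin 3 → k))

instance : Module k (RZModule q α) := inferInstanceAs (Module k (Fin 3 → k))

/-- The right action of `Λ(q)` on `M(α)`: `m · a` is the row vector `m` times the matrix of `a`. -/
noncomputable instance : Module (RZAlgebra q)ᵐᵒᵖ (RZModule q α) where
  smul a m := Matrix.vecMul (m : Fin 3 → k) (rzRep q α a.unop)
  one_smul m := (congrArg (Matrix.vecMul (m : Fin 3 → k)) (map_one (rzRep q α))).trans
    (Matrix.vecMul_one _)
  mul_smul a b m :=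
    (congrArg (Matrix.vecMul (m : Fin 3 → k)) (map_mul (rzRep q α) b.unop a.unop)).trans
      (Matrix.vecMul_vecMul _ _ _).symm
  smul_zero _ := Matrix.zero_vecMul _
  smul_add _ _ _ := Matrix.add_vecMul _ _ _
  add_smul a b m :=
    (congrArg (Matrix.vecMul (m : Fin 3 → k)) (map_add (rzRep q α) a.unop b.unop)).trans
      (Matrix.vecMul_add _ _ _)
  zero_smul m := (congrArg (Matrix.vecMul (m : Fin 3 → k)) (map_zero (rzRep q α))).trans
    (Matrix.vecMul_zero _)

instance : IsScalarTower k (RZAlgebra q)ᵐᵒᵖ (RZModule q α) where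
  smul_assoc c a m :=
    (congrArg (Matrix.vecMul (m : Fin 3 → k)) (map_smul (rzRep q α) c a.unop)).trans
      (Matrix.vecMul_smul _ _ _)

end RingelZhang

/-! For a right `B`-module `Y` let `J Y` be the submodule generated by `Yε`, so that `Y / J Y` is a
`Λ`-module. Put `a_n = x - q^n y` in `Λ`. Then `a_n a_{n+1} = 0`, every `r` with `r a_{n+1} = 0`
lies in `Λ a_n`, and `a_n z = (1 - q^n) zx`. The last product vanishes for `n = 0`; for `n ≥ 1` it
is a nonzero multiple of `zx`, because `q` has infinite order.

The invariant is the condition "`w a_n ∈ J Y` implies `wz ∈ Yx + J Y`", called `Good n`; `Bad n` is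
its negation. On torsionless modules both pass from `n` to `n + 1` under a syzygy
(`Good.of_isSyzygy`, `Bad.of_isSyzygy`), where torsionlessness ensures that `J` of a syzygy is cut
out by `J` of the projective (`mem_J_of_exact`).

Let `S` be the simple module at the extension vertex. Its syzygy is `Bad 1`: `v a_1 = 0`, yet `vz =
v''` is not reached. Every second syzygy is `Good 1`, because `a_0 z = 0`. Hence for `n ≥ 1`, `Ωⁿ S`
is `Bad n` and `Ωⁿ⁺¹ N` is `Good n`. Projectives are good too, so a bad module is no stable summand
of a good one. For `n = 0` it suffices that `S` is not torsionless.

In `R = Bᵐᵒᵖ` all products appear in reversed order. -/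

/-- Elements of a ring `R`, thought of as the opposite of a one-point extension of a local algebra,
and the relations between them that force an infinite delooping level. The `E i` generate the ideal
that is the kernel of the projection to the local algebra, `ε` is the idempotent of the extension
vertex, and `a n` is the generator of the annihilator of the `n`-th module of a chain of
syzygies. -/
structure LoopData (R : Type u) [Ring R] where
  ι : Type
  [fin : Fintype ι]
  E : ι → R
  ε : R
  x : R
  z : R
  v : R
  a : ℕ → R
  i₀ : ι
  left_mul_E : ∀ r i, ∃ c : ι → R, r * E i = ∑ j, E j * c j
  E_mul_ε : ∀ i, E i * ε = E i
  ε_mul_eq_zero : ∀ c : ι → R, ∑ j, E j * c j = 0 → ∀ j, ε * c j = 0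
  x_mul_x : x * x = 0
  a_mul_a : ∀ n, a (n + 1) * a n = 0
  z_mul_a_zero : z * a 0 = 0
  z_mul_a : ∀ n, 0 < n → ∃ c d : R, d * c = 1 ∧ c * x = x * c ∧ d * x = x * d ∧
    z * a n = c * (x * z)
  a_div : ∀ n r (c : ι → R), a (n + 1) * r = ∑ j, E j * c j →
    ∃ (t : R) (d : ι → R), r = a n * t + ∑ j, E j * d j
  x_div : ∀ r (c : ι → R), x * r = ∑ j, E j * c j →
    ∃ (t : R) (d : ι → R), r = x * t + ∑ j, E j * d j
  a_mul_v : a 1 * v = 0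
  z_mul_v : z * v = E i₀
  ε_mul_eq : ∀ (r s : R) (c : ι → R), E i₀ * r = x * s + ∑ j, E j * c j → ε * r = ε * c i₀

/-! ### The submodule `J` and torsionless modules -/

namespace LoopData

variable {R : Type u} [Ring R] (D : LoopData R)

attribute [instance] LoopData.fin

section Submodule

variable (Y : Type u) [AddCommGroup Y] [Module R Y]

/-- The submodule of a module generated by the multiples of the elements `E i`. -/
def J : Submodule R Y where
  carrier := {t | ∃ y : D.ι → Y, t = ∑ j, D.E j • y j}
  zero_mem' := ⟨0, by simp⟩
  add_mem' := by
    rintro _ _ ⟨y, rfl⟩ ⟨y', rfl⟩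
    exact ⟨y + y', by simp [Finset.sum_add_distrib]⟩
  smul_mem' := by
    rintro r _ ⟨y, rfl⟩
    choose c hc using D.left_mul_E r
    refine ⟨fun j => ∑ i, c i j • y i, ?_⟩
    simp only [Finset.smul_sum, smul_smul, hc, Finset.sum_smul]
    exact Finset.sum_comm

end Submodule

variable {D}

variable {Y : Type u} [AddCommGroup Y] [Module R Y] {Y' : Type u} [AddCommGroup Y'] [Module R Y']

theorem mem_J {t : Y} : t ∈ D.J Y ↔ ∃ y : D.ι → Y, t = ∑ j, D.E j • y j := Iff.rfl

theorem map_mem_J (f : Y →ₗ[R] Y') {t : Y} (h : t ∈ D.J Y) : f t ∈ D.J Y' := by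
  obtain ⟨y, rfl⟩ := h
  exact ⟨fun j => f (y j), by simp⟩

theorem exists_lift_mem_J {f : Y →ₗ[R] Y'} (hf : Function.Surjective f) {t : Y'}
    (h : t ∈ D.J Y') : ∃ s ∈ D.J Y, f s = t := by
  obtain ⟨y, rfl⟩ := h
  choose g hg using hf
  exact ⟨∑ j, D.E j • g (y j), ⟨_, rfl⟩, by simp [hg]⟩

/-- Division properties of the ring pass to projective modules. -/
theorem exists_eq_smul_add_of_projective [Module.Projective R Y] {b b' : R}
    (hb : ∀ r, b * r ∈ D.J R → ∃ t, ∃ j ∈ D.J R, r = b' * t + j) {w : Y} (hw : b • w ∈ D.J Y) :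
    ∃ t : Y, ∃ j ∈ D.J Y, w = b' • t + j := by
  obtain ⟨s, hs⟩ := Module.projective_def'.1 (inferInstance : Module.Projective R Y)
  have h (y : Y) : ∃ t, ∃ j ∈ D.J R, s w y = b' * t + j := by
    apply hb
    have := map_mem_J ((Finsupp.lapply y : (Y →₀ R) →ₗ[R] R) ∘ₗ s) hw
    simpa using this
  choose t j hj hw' using h
  refine ⟨∑ y ∈ (s w).support, t y • y, ∑ y ∈ (s w).support, j y • y,
    Submodule.sum_mem _ fun y _ => ?_, ?_⟩
  · simpa using map_mem_J (LinearMap.toSpanSingleton R Y y) (hj y)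
  · have h1 : w = Finsupp.linearCombination R id (s w) := (LinearMap.congr_fun hs w).symm
    conv_lhs => rw [h1]
    rw [Finsupp.linearCombination_apply, Finsupp.sum, Finset.smul_sum, ← Finset.sum_add_distrib]
    refine Finset.sum_congr rfl fun y _ => ?_
    rw [hw', add_smul, mul_smul]
    rfl

theorem a_div_of_projective [Module.Projective R Y] {n : ℕ} {w : Y}
    (hw : D.a (n + 1) • w ∈ D.J Y) : ∃ t : Y, ∃ j ∈ D.J Y, w = D.a n • t + j := by
  refine exists_eq_smul_add_of_projective (fun r hr => ?_) hw
  obtain ⟨c, hc⟩ := hr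
  obtain ⟨t, d, h⟩ := D.a_div n r c hc
  exact ⟨t, _, ⟨d, rfl⟩, h⟩

theorem x_div_of_projective [Module.Projective R Y] {w : Y}
    (hw : D.x • w ∈ D.J Y) : ∃ t : Y, ∃ j ∈ D.J Y, w = D.x • t + j := by
  refine exists_eq_smul_add_of_projective (fun r hr => ?_) hw
  obtain ⟨c, hc⟩ := hr
  obtain ⟨t, d, h⟩ := D.x_div r c hc
  exact ⟨t, _, ⟨d, rfl⟩, h⟩

/-- The module is torsionless: its linear functionals separate points. -/
def _root_.Torsionless (R : Type u) [Ring R] (Y : Type u) [AddCommGroup Y] [Module R Y] : Prop :=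
  ∀ y : Y, (∀ f : Y →ₗ[R] R, f y = 0) → y = 0

theorem _root_.Torsionless.of_projective [Module.Projective R Y] : Torsionless R Y := by
  obtain ⟨s, hs⟩ := Module.projective_def'.1 (inferInstance : Module.Projective R Y)
  intro y hy
  have h1 : Finsupp.linearCombination R id (s y) = y := LinearMap.congr_fun hs y
  have h2 : s y = 0 := by
    ext i
    exact hy ((Finsupp.lapply i : (Y →₀ R) →ₗ[R] R) ∘ₗ s)
  rw [← h1, h2, map_zero]

theorem _root_.Torsionless.of_injective (h : Torsionless R Y') (f : Y →ₗ[R] Y')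
    (hf : Function.Injective f) : Torsionless R Y := fun y hy =>
  hf <| by
    rw [map_zero]
    exact h _ fun g => hy (g ∘ₗ f)

theorem _root_.IsSyzygy.torsionless (h : IsSyzygy R Y Y') : Torsionless R Y' := by
  obtain ⟨P, _, _, i, p, -, hP, hi, -, -⟩ := h
  exact Torsionless.of_projective.of_injective i hi

theorem ε_smul_eq_zero (hY : Torsionless R Y) (y : D.ι → Y) (h : ∑ j, D.E j • y j = 0)
    (j : D.ι) : D.ε • y j = 0 := by
  refine hY _ fun f => ?_
  have := D.ε_mul_eq_zero (fun j => f (y j)) (by simpa using congrArg f h) j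
  simpa using this

theorem ε_smul_eq (hY : Torsionless R Y) {r s : Y} {c : D.ι → Y}
    (h : D.E D.i₀ • r = D.x • s + ∑ j, D.E j • c j) : D.ε • r = D.ε • c D.i₀ := by
  refine sub_eq_zero.1 (hY _ fun f => ?_)
  have := D.ε_mul_eq (f r) (f s) (fun j => f (c j)) (by simpa using congrArg f h)
  simpa [sub_eq_zero] using this

/-- The kernel of a map from a module to a torsionless one meets the submodule `J` of the source
in its own submodule `J`. -/
theorem mem_J_of_exact {K Q L : Type u} [AddCommGroup K] [Module R K] [AddCommGroup Q] [Module R Q]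
    [AddCommGroup L] [Module R L] {i : K →ₗ[R] Q} {p : Q →ₗ[R] L} (hL : Torsionless R L)
    (hi : Function.Injective i) (hip : Function.Exact i p) {w : K} (hw : i w ∈ D.J Q) :
    w ∈ D.J K := by
  obtain ⟨y, hy⟩ := hw
  have h0 : ∑ j, D.E j • p (y j) = 0 := by
    have := congrArg p hy
    rw [hip.apply_apply_eq_zero] at this
    simpa using this.symm
  -- Since `E j * ε = E j`, each `y j` may be replaced by `ε • y j`, which lies in the kernel.
  have h1 (j : D.ι) : ∃ κ : K, i κ = D.ε • y j :=
    (hip _).1 (by rw [map_smul]; exact ε_smul_eq_zero hL _ h0 j)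
  choose κ hκ using h1
  refine ⟨κ, hi ?_⟩
  simp only [hy, map_sum, map_smul, hκ, smul_smul, D.E_mul_ε]

/-! ### Good and bad modules along syzygies -/

variable (D) in
/-- The condition on a module that holds for all `(n + 1)`-st syzygies. -/
def Good (n : ℕ) (L : Type u) [AddCommGroup L] [Module R L] : Prop :=
  ∀ w : L, D.a n • w ∈ D.J L → ∃ l : L, ∃ j ∈ D.J L, D.z • w = D.x • l + j

variable (D) in
/-- The condition on a module that holds for all `n`-th syzygies of the simple module at the
extension vertex. -/
def Bad (n : ℕ) (K : Type u) [AddCommGroup K] [Module R K] : Prop :=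
  ∃ w : K, D.a n • w ∈ D.J K ∧ ∀ l : K, ∀ j ∈ D.J K, D.z • w ≠ D.x • l + j

theorem Good.of_projective [Module.Projective R Y] (n : ℕ) : D.Good (n + 1) Y := by
  intro w hw
  obtain ⟨t, j, hj, rfl⟩ := a_div_of_projective hw
  rcases Nat.eq_zero_or_pos n with rfl | hn
  · exact ⟨0, D.z • j, Submodule.smul_mem _ _ hj, by
      rw [smul_add, smul_smul, D.z_mul_a_zero, zero_smul, smul_zero]⟩
  · obtain ⟨c, d, -, hc, -, hz⟩ := D.z_mul_a n hn
    refine ⟨(c * D.z) • t, D.z • j, Submodule.smul_mem _ _ hj, ?_⟩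
    rw [smul_add, smul_smul, smul_smul, hz, ← mul_assoc, hc, mul_assoc]

/-- In the projective cover term, `w` is a multiple of `a 0` modulo `J`, and `z` kills `a 0`; so `z
• w` is already in `J`. -/
theorem good_one_of_isSyzygy {L K : Type u} [AddCommGroup K] [Module R K] [AddCommGroup L]
    [Module R L] (hL : Torsionless R L) (h : IsSyzygy R L K) : D.Good 1 K := by
  obtain ⟨Q, _, _, i, p, -, hQ, hi, hip, hp⟩ := h
  intro w hw
  have hw' : D.a 1 • i w ∈ D.J Q := by simpa using map_mem_J i hw
  obtain ⟨t, j, hj, ht⟩ := a_div_of_projective hw'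
  refine ⟨0, D.z • w, mem_J_of_exact hL hi hip ?_, by simp⟩
  rw [map_smul, ht, smul_add, smul_smul, D.z_mul_a_zero, zero_smul, zero_add]
  exact Submodule.smul_mem _ _ hj

theorem Good.of_isSyzygy {n : ℕ} (hn : 0 < n) {L K : Type u} [AddCommGroup K] [Module R K]
    [AddCommGroup L] [Module R L] (hL : Torsionless R L) (hG : D.Good n L) (h : IsSyzygy R L K) :
    D.Good (n + 1) K := by
  obtain ⟨Q, _, _, i, p, -, hQ, hi, hip, hp⟩ := h
  intro w hw
  have hw' : D.a (n + 1) • i w ∈ D.J Q := by simpa using map_mem_J i hw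
  obtain ⟨t, j, hj, ht⟩ := a_div_of_projective hw'
  have hpt : D.a n • p t ∈ D.J L := by
    have := congrArg p ht
    rw [hip.apply_apply_eq_zero, map_add, map_smul] at this
    rw [eq_neg_of_add_eq_zero_left this.symm]
    exact Submodule.neg_mem _ (map_mem_J p hj)
  obtain ⟨l, j', hj', hl⟩ := hG _ hpt
  obtain ⟨l', rfl⟩ := hp l
  obtain ⟨j', hj'', rfl⟩ := exists_lift_mem_J hp hj'
  obtain ⟨w', hw'⟩ := (hip (D.z • t - D.x • l' - j')).1 (by simp [hl])
  have hzt : D.z • t = i w' + D.x • l' + j' := by rw [hw']; abel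
  obtain ⟨c, d, -, hc, -, hz⟩ := D.z_mul_a n hn
  -- Goodness of `L` controls `z • t` only up to `x • l'` with `l'` outside `K`; multiplying by `x`
  -- removes that term, as `x * x = 0`.
  have key : D.z • i w = D.x • i (c • w') + ((c * D.x) • j' + D.z • j) := by
    have hx : D.x • D.x • l' = 0 := by rw [smul_smul, D.x_mul_x, zero_smul]
    rw [ht, smul_add, smul_smul, hz, mul_smul, mul_smul, hzt]
    simp only [smul_add, hx, zero_add, map_smul, smul_smul, hc, add_assoc]
  refine ⟨c • w', D.z • w - D.x • c • w', mem_J_of_exact hL hi hip ?_, by abel⟩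
  rw [map_sub, map_smul, map_smul, key, add_sub_cancel_left]
  exact Submodule.add_mem _ (Submodule.smul_mem _ _ hj'') (Submodule.smul_mem _ _ hj)

theorem Bad.of_isSyzygy {n : ℕ} (hn : 0 < n) {L K : Type u} [AddCommGroup K] [Module R K]
    [AddCommGroup L] [Module R L] (hL : Torsionless R L) (hB : D.Bad n L) (h : IsSyzygy R L K) :
    D.Bad (n + 1) K := by
  obtain ⟨Q, _, _, i, p, -, hQ, hi, hip, hp⟩ := h
  obtain ⟨w, hw, hw'⟩ := hB
  obtain ⟨t, rfl⟩ := hp w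
  obtain ⟨j, hj, hjt⟩ := exists_lift_mem_J hp hw
  -- The new bad element is the lift of the old one multiplied by `a n`, corrected by `j` to lie in
  -- `K`.
  obtain ⟨w', hi'⟩ := (hip (D.a n • t - j)).1 (by simp [hjt])
  refine ⟨w', mem_J_of_exact hL hi hip ?_, fun l j' hj' h => ?_⟩
  · rw [map_smul, hi', smul_sub, smul_smul, D.a_mul_a, zero_smul, zero_sub]
    exact Submodule.neg_mem _ (Submodule.smul_mem _ _ hj)
  -- Invertibility of `c`, that is `q ^ n ≠ 1` in the application, is essential here: it lets `x • z
  -- • t` be isolated, so that division by `x` contradicts badness of `w`.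
  · obtain ⟨c, d, hdc, hc, hd, hz⟩ := D.z_mul_a n hn
    have h1 : D.x • D.z • t = D.x • i (d • l) + d • (i j' + D.z • j) := by
      have h2 : c • D.x • D.z • t = D.x • i l + (i j' + D.z • j) := by
        have h3 := congrArg i h
        rw [map_smul, hi', map_add, map_smul, smul_sub, smul_smul, hz, sub_eq_iff_eq_add] at h3
        rw [smul_smul, smul_smul, mul_assoc, h3, add_assoc]
      have h4 := congrArg (d • ·) h2
      simp only [smul_smul, ← mul_assoc, hdc, one_mul, smul_add] at h4
      simp only [smul_smul, map_smul, smul_add, ← hd, h4]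
    obtain ⟨r, j'', hj'', hr⟩ := x_div_of_projective (D := D) (w := D.z • t - i (d • l)) (by
      rw [smul_sub, h1, add_sub_cancel_left]
      exact Submodule.smul_mem _ _
        (Submodule.add_mem _ (map_mem_J i hj') (Submodule.smul_mem _ _ hj)))
    refine hw' (p r) (p j'') (map_mem_J p hj'') ?_
    have := congrArg p hr
    rwa [map_sub, map_smul, hip.apply_apply_eq_zero, sub_zero, map_add, map_smul] at this

/-- `z • v • t = E i₀ • t` lies in `J Q`, but writing it with coefficients from `K` would force `ε •
t` into `K`, hence `s = 0`. -/
theorem bad_one_of_isSyzygy {S K : Type u} [AddCommGroup K] [Module R K] [AddCommGroup S]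
    [Module R S] {s : S} (hs : s ≠ 0) (hε : D.ε • s = s) (hv : D.v • s = 0)
    (h : IsSyzygy R S K) : D.Bad 1 K := by
  obtain ⟨Q, _, _, i, p, -, hQ, hi, hip, hp⟩ := h
  obtain ⟨t, rfl⟩ := hp s
  obtain ⟨w, hw⟩ := (hip (D.v • t)).1 (by simp [hv])
  have hw0 : D.a 1 • w = 0 := hi (by
    rw [map_smul, hw, smul_smul, D.a_mul_v, zero_smul, map_zero])
  refine ⟨w, by rw [hw0]; exact Submodule.zero_mem _, ?_⟩
  rintro l _ ⟨y, rfl⟩ h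
  have h1 : D.E D.i₀ • t = D.x • i l + ∑ j, D.E j • i (y j) := by
    have := congrArg i h
    rw [map_smul, hw, smul_smul, D.z_mul_v] at this
    simpa using this
  have h2 := congrArg p (ε_smul_eq Torsionless.of_projective h1)
  rw [map_smul, hε, map_smul, hip.apply_apply_eq_zero, smul_zero] at h2
  exact hs h2

/-- The relation `E i₀ • f s = z • v • f s = 0` forces `ε • f s = 0`. Thus a nonzero such `s` shows
that `S` is not torsionless. -/
theorem map_eq_zero_of_torsionless {S : Type u} [AddCommGroup S] [Module R S] {s : S}
    (hε : D.ε • s = s) (hv : D.v • s = 0) (hY : Torsionless R Y) (f : S →ₗ[R] Y) : f s = 0 := by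
  have h1 : D.E D.i₀ • f s = D.x • (0 : Y) + ∑ j, D.E j • (fun _ => (0 : Y)) j := by
    rw [← D.z_mul_v, mul_smul, ← map_smul, hv]
    simp
  have := ε_smul_eq hY h1
  rwa [← map_smul, hε, smul_zero] at this

/-- The index `m` and the module vary in the induction because `IsNthSyzygy` peels off the syzygy
closest to the module. -/
theorem Bad.of_isNthSyzygy {n : ℕ} :
    ∀ {m : ℕ} {L K : Type u} [AddCommGroup K] [Module R K] [AddCommGroup L] [Module R L],
      0 < m → Torsionless R L → D.Bad m L → IsNthSyzygy R n L K → D.Bad (m + n) K := by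
  induction n with
  | zero =>
    rintro m L K _ _ _ _ hm hL ⟨w, hw, hw'⟩ ⟨e⟩
    refine ⟨e.symm w, by simpa using map_mem_J e.symm.toLinearMap hw, fun l j hj h => ?_⟩
    refine hw' (e l) (e j) (map_mem_J e.toLinearMap hj) ?_
    simpa using congrArg e h
  | succ n ih =>
    rintro m L K _ _ _ _ hm hL hB ⟨L', _, _, h, h'⟩
    rw [add_comm n 1, ← add_assoc]
    exact ih m.succ_pos h.torsionless (hB.of_isSyzygy hm hL h) h'

theorem Good.of_isNthSyzygy {n : ℕ} :
    ∀ {m : ℕ} {L K : Type u} [AddCommGroup K] [Module R K] [AddCommGroup L] [Module R L],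
      0 < m → Torsionless R L → D.Good m L → IsNthSyzygy R n L K → D.Good (m + n) K := by
  induction n with
  | zero =>
    rintro m L K _ _ _ _ hm hL hG ⟨e⟩ w hw
    obtain ⟨l, j, hj, h⟩ := hG (e w) (by simpa using map_mem_J e.toLinearMap hw)
    refine ⟨e.symm l, e.symm j, map_mem_J e.symm.toLinearMap hj, e.injective ?_⟩
    simpa using h
  | succ n ih =>
    rintro m L K _ _ _ _ hm hL hG ⟨L', _, _, h, h'⟩
    rw [add_comm n 1, ← add_assoc]
    exact ih m.succ_pos h.torsionless (hG.of_isSyzygy hm hL h) h'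

/-- A stable summand of a good module is not bad. -/
theorem not_isStableSummand {n : ℕ} {K L : Type u} [AddCommGroup K] [Module R K]
    [AddCommGroup L] [Module R L] (hK : D.Bad (n + 1) K) (hL : D.Good (n + 1) L) :
    ¬ IsStableSummand R K L := by
  rintro ⟨Z, _, _, -, f, g, ⟨P, _, _, α, β, -, hP, hαβ⟩, -⟩
  obtain ⟨w, hw, hw'⟩ := hK
  have h0 : LinearMap.fst R K Z (g (f (w, 0))) - w = LinearMap.fst R K Z (β (α (w, 0))) := by
    simpa using congrArg Prod.fst (LinearMap.congr_fun hαβ (w, 0))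
  obtain ⟨l, j, hj, h1⟩ := hL (f (w, 0)) (by
    simpa using map_mem_J (f ∘ₗ LinearMap.inl R K Z) hw)
  obtain ⟨l', j', hj', h2⟩ := Good.of_projective (D := D) n (α (w, 0)) (by
    simpa using map_mem_J (α ∘ₗ LinearMap.inl R K Z) hw)
  refine hw' ((LinearMap.fst R K Z ∘ₗ g) l - (LinearMap.fst R K Z ∘ₗ β) l')
    ((LinearMap.fst R K Z ∘ₗ g) j - (LinearMap.fst R K Z ∘ₗ β) j')
    (Submodule.sub_mem _ (map_mem_J _ hj) (map_mem_J _ hj')) ?_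
  have h3 := congrArg (LinearMap.fst R K Z ∘ₗ g) h1
  have h4 := congrArg (LinearMap.fst R K Z ∘ₗ β) h2
  rw [map_add, map_smul, map_smul] at h3 h4
  rw [smul_sub, sub_add_sub_comm, ← h3, ← h4, ← smul_sub]
  congr 1
  simp only [LinearMap.comp_apply]
  rw [← h0]
  abel

theorem not_isDeloopedAt {S : Type u} [AddCommGroup S] [Module R S] {s : S} (hs : s ≠ 0)
    (hε : D.ε • s = s) (hv : D.v • s = 0) (n : ℕ) : ¬ IsDeloopedAt R n S := by
  rintro ⟨K, _, _, N, _, _, L, _, _, hK, -, ⟨L₁, _, _, hNL, hL⟩, hKL⟩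
  cases n with
  | zero =>
    obtain ⟨e⟩ := hK
    obtain ⟨e'⟩ := hL
    obtain ⟨Z, _, _, -, f, g, ⟨P, _, _, α, β, -, hP, hαβ⟩, -⟩ := hKL
    have h1 := map_eq_zero_of_torsionless hε hv
      (hNL.torsionless.of_injective e'.toLinearMap e'.injective)
      (f ∘ₗ LinearMap.inl R K Z ∘ₗ e.symm.toLinearMap)
    have h2 := map_eq_zero_of_torsionless hε hv (Torsionless.of_projective (R := R) (Y := P))
      (α ∘ₗ LinearMap.inl R K Z ∘ₗ e.symm.toLinearMap)
    have h3 := LinearMap.congr_fun hαβ (e.symm s, 0)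
    simp only [LinearMap.comp_apply, LinearMap.inl_apply, LinearEquiv.coe_coe] at h1 h2
    simp only [LinearMap.sub_apply, LinearMap.comp_apply, h1, h2, map_zero, zero_sub,
      LinearMap.id_apply, neg_eq_zero, Prod.mk_eq_zero, and_true,
      LinearEquiv.map_eq_zero_iff] at h3
    exact hs h3
  | succ n =>
    obtain ⟨K₁, _, _, hSK, hK⟩ := hK
    obtain ⟨L₂, _, _, hL₂, hL⟩ := hL
    have hbad := Bad.of_isNthSyzygy one_pos hSK.torsionless
      (bad_one_of_isSyzygy hs hε hv hSK) hK
    -- The first syzygy of `N` only supplies torsionlessness; the count of good levels begins at the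
    -- second.
    have hgood := Good.of_isNthSyzygy one_pos hL₂.torsionless
      (good_one_of_isSyzygy (D := D) hNL.torsionless hL₂) hL
    rw [add_comm] at hbad hgood
    exact not_isStableSummand hbad hgood hKL

end LoopData

/-! ### Normal forms and annihilators in `Λ(q)` -/

section RZAlgebra

variable {k : Type u} [Field k] (q : k)

/-- The generators of `Λ(q)`. -/
noncomputable def rzGen (g : RZGen) : RZAlgebra q :=
  RingQuot.mkAlgHom k (RZRel q) (FreeAlgebra.ι k g)

local notation "X" => rzGen q RZGen.x
local notation "Y" => rzGen q RZGen.y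
local notation "Z" => rzGen q RZGen.z

theorem rzGen_xx : X * X = 0 := by
  simpa [rzGen] using RingQuot.mkAlgHom_rel k (RZRel.xx (q := q))

theorem rzGen_yy : Y * Y = 0 := by
  simpa [rzGen] using RingQuot.mkAlgHom_rel k (RZRel.yy (q := q))

theorem rzGen_zz : Z * Z = 0 := by
  simpa [rzGen] using RingQuot.mkAlgHom_rel k (RZRel.zz (q := q))

theorem rzGen_zy : Z * Y = 0 := by
  simpa [rzGen] using RingQuot.mkAlgHom_rel k (RZRel.zy (q := q))

theorem rzGen_yx : Y * X = (-q) • (X * Y) := by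
  have h : Y * X + q • (X * Y) = 0 := by
    simpa [rzGen] using RingQuot.mkAlgHom_rel k (RZRel.yx (q := q))
  calc Y * X = Y * X + (q + -q) • (X * Y) := by rw [add_neg_cancel, zero_smul, add_zero]
    _ = (-q) • (X * Y) := by rw [add_smul, ← add_assoc, h, zero_add]

theorem rzGen_zx : Z * X = X * Z := by
  simpa [rzGen, sub_eq_zero] using RingQuot.mkAlgHom_rel k (RZRel.zx (q := q))

theorem rzGen_yz : Y * Z = X * Z := by
  simpa [rzGen, sub_eq_zero] using RingQuot.mkAlgHom_rel k (RZRel.yz (q := q))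

/-- The element of `Λ(q)` with given coordinates with respect to `1, x, y, z, xy, xz`. -/
noncomputable def rzNormal (c : Fin 6 → k) : RZAlgebra q :=
  c 0 • 1 + c 1 • X + c 2 • Y + c 3 • Z + c 4 • (X * Y) + c 5 • (X * Z)

theorem rzNormal_add (c d : Fin 6 → k) :
    rzNormal q c + rzNormal q d = rzNormal q (c + d) := by
  simp only [rzNormal, Pi.add_apply, add_smul]
  abel

theorem rzNormal_mul_x (c : Fin 6 → k) :
    rzNormal q c * X = rzNormal q ![0, c 0, 0, 0, -q * c 2, c 3] := by
  have h1 : X * Y * X = 0 := by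
    rw [mul_assoc, rzGen_yx, mul_smul_comm, ← mul_assoc, rzGen_xx, zero_mul, smul_zero]
  have h2 : X * Z * X = 0 := by rw [mul_assoc, rzGen_zx, ← mul_assoc, rzGen_xx, zero_mul]
  simp only [rzNormal, add_mul, smul_mul_assoc, one_mul, h1, h2, rzGen_xx, rzGen_yx, rzGen_zx]
  simp [smul_smul, mul_comm (c 2), -neg_smul, -neg_mul, -mul_neg]

theorem rzNormal_mul_y (c : Fin 6 → k) :
    rzNormal q c * Y = rzNormal q ![0, 0, c 0, 0, c 1, 0] := by
  have h1 : X * Y * Y = 0 := by rw [mul_assoc, rzGen_yy, mul_zero]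
  have h2 : X * Z * Y = 0 := by rw [mul_assoc, rzGen_zy, mul_zero]
  simp only [rzNormal, add_mul, smul_mul_assoc, one_mul, h1, h2, rzGen_yy, rzGen_zy]
  simp

theorem rzNormal_mul_z (c : Fin 6 → k) :
    rzNormal q c * Z = rzNormal q ![0, 0, 0, c 0, 0, c 1 + c 2] := by
  have h1 : X * Y * Z = 0 := by rw [mul_assoc, rzGen_yz, ← mul_assoc, rzGen_xx, zero_mul]
  have h2 : X * Z * Z = 0 := by rw [mul_assoc, rzGen_zz, mul_zero]
  simp only [rzNormal, add_mul, smul_mul_assoc, one_mul, h1, h2, rzGen_yz, rzGen_zz]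
  simp [add_smul, add_assoc]

theorem exists_eq_rzNormal (r : RZAlgebra q) : ∃ c, r = rzNormal q c := by
  obtain ⟨f, rfl⟩ := RingQuot.mkAlgHom_surjective k (RZRel q) r
  -- With an arbitrary normal form on the left, the induction needs only right multiplication by
  -- generators.
  suffices ∀ c, ∃ d, rzNormal q c * RingQuot.mkAlgHom k (RZRel q) f = rzNormal q d by
    obtain ⟨d, hd⟩ := this ![1, 0, 0, 0, 0, 0]
    exact ⟨d, by rw [← hd]; simp [rzNormal]⟩
  induction f using FreeAlgebra.induction with
  | grade0 r =>
    refine fun c => ⟨r • c, ?_⟩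
    rw [AlgHom.commutes, ← Algebra.commutes, ← Algebra.smul_def]
    simp [rzNormal, mul_smul]
  | grade1 g =>
    intro c
    cases g
    · exact ⟨_, rzNormal_mul_x q c⟩
    · exact ⟨_, rzNormal_mul_y q c⟩
    · exact ⟨_, rzNormal_mul_z q c⟩
  | mul a b ha hb =>
    intro c
    obtain ⟨d, hd⟩ := ha c
    obtain ⟨e, he⟩ := hb d
    exact ⟨e, by rw [map_mul, ← mul_assoc, hd, he]⟩
  | add a b ha hb =>
    intro c
    obtain ⟨d, hd⟩ := ha c
    obtain ⟨e, he⟩ := hb c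
    refine ⟨d + e, ?_⟩
    rw [map_add, mul_add, hd, he, rzNormal_add]

/-- The matrices of right multiplication by the generators of `Λ(q)` on `Λ(q)`. -/
def rzRegularMatrix : RZGen → Matrix (Fin 6) (Fin 6) k
  | RZGen.x => !![0, 1, 0, 0, 0, 0; 0, 0, 0, 0, 0, 0; 0, 0, 0, 0, -q, 0; 0, 0, 0, 0, 0, 1;
      0, 0, 0, 0, 0, 0; 0, 0, 0, 0, 0, 0]
  | RZGen.y => !![0, 0, 1, 0, 0, 0; 0, 0, 0, 0, 1, 0; 0, 0, 0, 0, 0, 0; 0, 0, 0, 0, 0, 0;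
      0, 0, 0, 0, 0, 0; 0, 0, 0, 0, 0, 0]
  | RZGen.z => !![0, 0, 0, 1, 0, 0; 0, 0, 0, 0, 0, 1; 0, 0, 0, 0, 0, 1; 0, 0, 0, 0, 0, 0;
      0, 0, 0, 0, 0, 0; 0, 0, 0, 0, 0, 0]

/-- The right regular representation of `Λ(q)`. -/
noncomputable def rzRegularRep : RZAlgebra q →ₐ[k] Matrix (Fin 6) (Fin 6) k :=
  RingQuot.liftAlgHom k ⟨FreeAlgebra.lift k (rzRegularMatrix q), by
    intro a b h
    cases h <;> simp [rzRegularMatrix] <;> ext i j <;> fin_cases i <;> fin_cases j <;> rfl⟩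

theorem rzRegularRep_rzGen (g : RZGen) : rzRegularRep q (rzGen q g) = rzRegularMatrix q g := by
  simp [rzRegularRep, rzGen]

/-- Row `0` records `1 · r`, so this yields linear independence of the six monomials. -/
theorem rzRegularRep_rzNormal (c : Fin 6 → k) : rzRegularRep q (rzNormal q c) 0 = c := by
  simp only [rzNormal, map_add, map_smul, map_mul, map_one, rzRegularRep_rzGen]
  ext j
  fin_cases j <;> simp [rzRegularMatrix]

theorem rzNormal_eq_zero {c : Fin 6 → k} (h : rzNormal q c = 0) : c = 0 := by
  rw [← rzRegularRep_rzNormal q c, h, map_zero]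
  rfl

theorem rzNormal_smul (r : k) (c : Fin 6 → k) : r • rzNormal q c = rzNormal q (r • c) := by
  simp [rzNormal, mul_smul]

theorem rz_div {q : k} (hq : q ≠ 0) (n : ℕ) {r : RZAlgebra q}
    (h : r * (rzGen q RZGen.x + (-q ^ (n + 1)) • rzGen q RZGen.y) = 0) :
    ∃ t, r = t * (rzGen q RZGen.x + (-q ^ n) • rzGen q RZGen.y) := by
  obtain ⟨c, rfl⟩ := exists_eq_rzNormal q r
  rw [mul_add, mul_smul_comm, rzNormal_mul_x, rzNormal_mul_y, rzNormal_smul, rzNormal_add] at h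
  have h0 := rzNormal_eq_zero q h
  have h1 : c 0 = 0 := by simpa using congrFun h0 1
  have h4 : q * (c 2 + q ^ n * c 1) = 0 := by
    have : -(q * c 2) + -(q ^ (n + 1) * c 1) = 0 := by simpa using congrFun h0 4
    linear_combination -this
  have h5 : c 3 = 0 := by simpa using congrFun h0 5
  have h6 : c 2 + q ^ n * c 1 = 0 := (mul_eq_zero.1 h4).resolve_left hq
  -- The coefficients of `y` and `z` in `t` produce `xy` and `xz` through `yx = -q xy` and `zx =
  -- xz`; `yy = zy = 0` leaves no other contribution.
  refine ⟨rzNormal q ![c 1, 0, -(q⁻¹ * c 4), c 5, 0, 0], ?_⟩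
  rw [mul_add, mul_smul_comm, rzNormal_mul_x, rzNormal_mul_y, rzNormal_smul, rzNormal_add]
  congr 1
  ext j
  fin_cases j <;> simp [h1, h5, hq]
  linear_combination h6

theorem rz_x_div {q : k} (hq : q ≠ 0) {r : RZAlgebra q} (h : r * rzGen q RZGen.x = 0) :
    ∃ t, r = t * rzGen q RZGen.x := by
  obtain ⟨c, rfl⟩ := exists_eq_rzNormal q r
  rw [rzNormal_mul_x] at h
  have h0 := rzNormal_eq_zero q h
  have h1 : c 0 = 0 := by simpa using congrFun h0 1
  have h4 : c 2 = 0 := by simpa [hq] using congrFun h0 4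
  have h5 : c 3 = 0 := by simpa using congrFun h0 5
  refine ⟨rzNormal q ![c 1, 0, -(q⁻¹ * c 4), c 5, 0, 0], ?_⟩
  rw [rzNormal_mul_x]
  congr 1
  ext j
  fin_cases j <;> simp [h1, h4, h5, hq]

instance : Module.Finite k (RZAlgebra q) :=
  Module.Finite.of_surjective
    { toFun := rzNormal q
      map_add' := fun c d => (rzNormal_add q c d).symm
      map_smul' := fun r c => (rzNormal_smul q r c).symm : (Fin 6 → k) →ₗ[k] RZAlgebra q }
    fun r => by
      obtain ⟨c, rfl⟩ := exists_eq_rzNormal q r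
      exact ⟨c, rfl⟩

/-- A vector of `M(α)` with given coordinates. -/
def rzVec (α : k) (c : Fin 3 → k) : RZModule q α := c

theorem rzGen_smul (α : k) (g : RZGen) (m : RZModule q α) :
    op (rzGen q g) • m = rzVec q α (Matrix.vecMul (m : Fin 3 → k) (rzMatrix α g)) := by
  change Matrix.vecMul (m : Fin 3 → k) (rzRep q α (rzGen q g)) = _
  simp [rzRep, rzGen, rzVec]

omit [Field k] in
theorem rzVec_apply (α : k) (c : Fin 3 → k) (i : Fin 3) : rzVec q α c i = c i := rfl

theorem RZModule.add_apply {α : k} (m m' : RZModule q α) (i : Fin 3) :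
    (m + m') i = m i + m' i := rfl

theorem RZModule.smul_apply {α : k} (c : k) (m : RZModule q α) (i : Fin 3) :
    (c • m) i = c * m i := rfl

theorem RZModule.zero_apply {α : k} (i : Fin 3) : (0 : RZModule q α) i = 0 := rfl

end RZAlgebra

/-! ### The one-point extension as an instance of `LoopData` -/

namespace OnePointExtension

instance {k A M : Type u} [Field k] [Ring A] [AddCommGroup M] [Algebra k A] [Module k M]
    [Module.Finite k A] [Module.Finite k M] : Module.Finite k (OnePointExtension k A M) :=
  Module.Finite.of_surjective
    { toFun := (equivProd k A M).symm
      map_add' := fun _ _ => rfl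
      map_smul' := fun _ _ => rfl : k × M × A →ₗ[k] OnePointExtension k A M }
    (equivProd k A M).symm.surjective

end OnePointExtension

section RZExtension

variable {k : Type u} [Field k] (q : k)

/-- The one-point extension of `Λ(q)` by `M(q)`. -/
abbrev RZExtension : Type u := OnePointExtension k (RZAlgebra q) (RZModule q q)

/-- The matrix units spanning the first row of the one-point extension. -/
def rzE : Fin 4 → (RZExtension q)ᵐᵒᵖ :=
  ![op ⟨1, 0, 0⟩, op ⟨0, rzVec q q ![1, 0, 0], 0⟩, op ⟨0, rzVec q q ![0, 1, 0], 0⟩,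
    op ⟨0, rzVec q q ![0, 0, 1], 0⟩]

/-- An element of `Λ(q)` as an element of the opposite of the one-point extension. -/
def rzIncl (r : RZAlgebra q) : (RZExtension q)ᵐᵒᵖ := op ⟨0, 0, r⟩

/-- A matrix multiplying a first-row matrix from the left acts only through its scalar entry. -/
theorem sum_rzE_mul (c : Fin 4 → (RZExtension q)ᵐᵒᵖ) :
    ∑ j, rzE q j * c j = op ⟨(c 0).unop.scalar,
      rzVec q q ![(c 1).unop.scalar, (c 2).unop.scalar, (c 3).unop.scalar], 0⟩ := by
  apply unop_injective
  rw [Fin.sum_univ_four]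
  ext
  · simp [rzE]
  · simp only [rzE, unop_add, unop_mul, OnePointExtension.add_vec, OnePointExtension.mul_vec]
    funext i
    simp only [Matrix.cons_val]
    simp only [unop_op, op_zero, zero_smul, smul_zero, add_zero, zero_add, RZModule.add_apply,
      RZModule.smul_apply, rzVec_apply]
    fin_cases i <;> simp
  · simp [rzE]

theorem exists_eq_sum_rzE_mul {r : (RZExtension q)ᵐᵒᵖ} (h : r.unop.alg = 0) :
    ∃ c : Fin 4 → (RZExtension q)ᵐᵒᵖ, r = ∑ j, rzE q j * c j := by
  refine ⟨![op ⟨r.unop.scalar, 0, 0⟩, op ⟨r.unop.vec 0, 0, 0⟩, op ⟨r.unop.vec 1, 0, 0⟩,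
    op ⟨r.unop.vec 2, 0, 0⟩], ?_⟩
  rw [sum_rzE_mul]
  apply unop_injective
  ext
  · rfl
  · funext i
    fin_cases i <;> rfl
  · exact h

theorem rzIncl_smul (c : k) (r : RZAlgebra q) : rzIncl q (c • r) = c • rzIncl q r := by
  apply unop_injective
  ext <;> simp [rzIncl]

theorem rzIncl_mul (r s : RZAlgebra q) : rzIncl q r * rzIncl q s = rzIncl q (s * r) := by
  apply unop_injective
  ext <;> simp [rzIncl]

/-- The ideal spanned by the first row is the kernel of the projection to `Λ`, so division modulo it
is division in `Λ`. -/
theorem exists_eq_rzIncl_mul_add {a b : RZAlgebra q}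
    (hab : ∀ r, r * a = 0 → ∃ t, r = t * b) (r : (RZExtension q)ᵐᵒᵖ)
    (c : Fin 4 → (RZExtension q)ᵐᵒᵖ) (h : rzIncl q a * r = ∑ j, rzE q j * c j) :
    ∃ (t : (RZExtension q)ᵐᵒᵖ) (d : Fin 4 → (RZExtension q)ᵐᵒᵖ),
      r = rzIncl q b * t + ∑ j, rzE q j * d j := by
  rw [sum_rzE_mul] at h
  obtain ⟨t, ht⟩ := hab r.unop.alg (congrArg (fun s => s.unop.alg) h)
  obtain ⟨d, hd⟩ := exists_eq_sum_rzE_mul q (r := r - rzIncl q b * rzIncl q t) (by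
    have h0 (s s' : RZExtension q) : (s - s').alg = s.alg - s'.alg := rfl
    rw [rzIncl_mul, unop_sub, h0, sub_eq_zero]
    exact ht)
  exact ⟨rzIncl q t, d, by rw [← hd]; abel⟩

variable {q}

/-- The elements of the one-point extension that obstruct delooping. -/
noncomputable def rzLoopData (hq0 : q ≠ 0) (hq : ∀ n : ℕ, 0 < n → q ^ n ≠ 1) :
    LoopData (RZExtension q)ᵐᵒᵖ where
  ι := Fin 4
  E := rzE q
  ε := rzE q 0
  x := rzIncl q (rzGen q RZGen.x)
  z := rzIncl q (rzGen q RZGen.z)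
  v := rzE q 1
  a n := rzIncl q (rzGen q RZGen.x + (-q ^ n) • rzGen q RZGen.y)
  i₀ := 3
  left_mul_E r i := exists_eq_sum_rzE_mul q (by fin_cases i <;> simp [rzE])
  E_mul_ε i := by
    apply unop_injective
    fin_cases i <;> ext <;> simp [rzE]
  ε_mul_eq_zero c h := by
    rw [sum_rzE_mul] at h
    have h0 : (c 0).unop.scalar = 0 := congrArg (fun s => s.unop.scalar) h
    have h1 : rzVec q q ![(c 1).unop.scalar, (c 2).unop.scalar, (c 3).unop.scalar] = 0 :=
      congrArg (fun s => s.unop.vec) h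
    have h2 (j : Fin 4) : (c j).unop.scalar = 0 := by
      fin_cases j
      · exact h0
      · exact congrFun h1 0
      · exact congrFun h1 1
      · exact congrFun h1 2
    intro j
    apply unop_injective
    ext <;> simp [rzE, h2]
  x_mul_x := by
    rw [rzIncl_mul, rzGen_xx]
    rfl
  a_mul_a n := by
    have : (rzGen q RZGen.x + (-q ^ n) • rzGen q RZGen.y) *
        (rzGen q RZGen.x + (-q ^ (n + 1)) • rzGen q RZGen.y) = 0 := by
      simp only [mul_add, add_mul, smul_mul_assoc, mul_smul_comm, rzGen_xx, rzGen_yy, rzGen_yx,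
        smul_zero, smul_smul, zero_add, add_zero, ← add_smul]
      rw [show -q ^ n * -q + -q ^ (n + 1) = 0 by ring, zero_smul]
    rw [rzIncl_mul, this]
    rfl
  z_mul_a_zero := by
    have : rzGen q RZGen.x * rzGen q RZGen.z + (-q ^ 0) • (rzGen q RZGen.x * rzGen q RZGen.z) = 0 := by
      nth_rw 1 [← one_smul k (rzGen q RZGen.x * rzGen q RZGen.z)]
      rw [← add_smul, pow_zero, add_neg_cancel, zero_smul]
    rw [rzIncl_mul, add_mul, smul_mul_assoc, rzGen_yz, this]
    rfl
  z_mul_a n hn := by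
    have h : 1 - q ^ n ≠ 0 := sub_ne_zero.2 (hq n hn).symm
    refine ⟨(1 - q ^ n) • 1, (1 - q ^ n)⁻¹ • 1, ?_, ?_, ?_, ?_⟩
    · rw [smul_mul_smul_comm, inv_mul_cancel₀ h, one_smul, one_mul]
    · rw [smul_mul_assoc, mul_smul_comm, one_mul, mul_one]
    · rw [smul_mul_assoc, mul_smul_comm, one_mul, mul_one]
    · rw [smul_mul_assoc, one_mul, rzIncl_mul, rzIncl_mul, add_mul, smul_mul_assoc, rzGen_yz,
        rzGen_zx, ← rzIncl_smul, sub_eq_add_neg, add_smul, one_smul]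
  a_div n := exists_eq_rzIncl_mul_add q fun _ => rz_div hq0 n
  x_div := exists_eq_rzIncl_mul_add q fun _ => rz_x_div hq0
  a_mul_v := by
    apply unop_injective
    ext
    · simp [rzE, rzIncl]
    · have h (m : RZModule q q) : op (rzGen q RZGen.x + (-q ^ 1) • rzGen q RZGen.y) • m =
          op (rzGen q RZGen.x) • m + (-q) • op (rzGen q RZGen.y) • m := by
        rw [op_add, add_smul, pow_one, op_smul, smul_assoc]
      simp only [rzE, rzIncl, unop_mul, OnePointExtension.mul_vec, Matrix.cons_val, unop_op, h,
        rzGen_smul, smul_zero, zero_add]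
      funext i
      simp only [RZModule.add_apply, RZModule.smul_apply, rzVec_apply, unop_zero,
        OnePointExtension.zero_vec, RZModule.zero_apply]
      fin_cases i <;> simp [rzVec, rzMatrix, Matrix.vecMul, dotProduct, Fin.sum_univ_three]
    · simp [rzE, rzIncl]
  z_mul_v := by
    apply unop_injective
    ext
    · simp [rzE, rzIncl]
    · simp only [rzE, rzIncl, unop_mul, OnePointExtension.mul_vec, Matrix.cons_val, unop_op,
        rzGen_smul, smul_zero, zero_add]
      funext i
      fin_cases i <;> simp [rzVec, rzMatrix, Matrix.vecMul, dotProduct, Fin.sum_univ_three]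
    · simp [rzE, rzIncl]
  ε_mul_eq r s c h := by
    rw [sum_rzE_mul] at h
    have h1 := congrArg (fun t => t.unop.vec) h
    simp only [rzE, rzIncl, unop_add, unop_mul, OnePointExtension.mul_vec, Matrix.cons_val,
      unop_op, rzGen_smul, smul_zero, zero_add, op_zero, zero_smul, add_zero,
      OnePointExtension.add_vec] at h1
    -- Right multiplication by `x` maps `M(q)` into the span of `v'`, so the `v''` coordinate does
    -- not see `s`.
    have h3 : r.unop.scalar = (c 3).unop.scalar := by
      simpa [rzMatrix, Matrix.vecMul, dotProduct, Fin.sum_univ_three, RZModule.add_apply,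
        RZModule.smul_apply, rzVec_apply] using congrFun h1 2
    apply unop_injective
    ext <;> simp [rzE, h3]

/-! ### The simple module at the extension vertex -/

variable (q) in
/-- The character of the opposite one-point extension at the extension vertex. -/
def rzScalar : (RZExtension q)ᵐᵒᵖ →+* k where
  toFun b := b.unop.scalar
  map_one' := rfl
  map_mul' _ _ := mul_comm _ _
  map_zero' := rfl
  map_add' _ _ := rfl

theorem rzScalar_surjective : Function.Surjective (rzScalar q) := fun c => ⟨op ⟨c, 0, 0⟩, rfl⟩

theorem dell_rzExtension (hq0 : q ≠ 0) (hq : ∀ n : ℕ, 0 < n → q ^ n ≠ 1) :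
    dell (RZExtension q) = ⊤ := by
  let : Module (RZExtension q)ᵐᵒᵖ k := Module.compHom k (rzScalar q)
  have smul_def (b : (RZExtension q)ᵐᵒᵖ) (c : k) : b • c = b.unop.scalar * c := rfl
  have hS : IsSimpleModule (RZExtension q)ᵐᵒᵖ k := by
    rw [isSimpleModule_iff_toSpanSingleton_surjective]
    refine ⟨inferInstance, fun m hm c => ?_⟩
    obtain ⟨b, hb⟩ := rzScalar_surjective (q := q) (c * m⁻¹)
    refine ⟨b, ?_⟩
    change rzScalar q b * m = c
    rw [hb, inv_mul_cancel_right₀ hm]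
  refine top_unique (le_iSup₂_of_le (ModuleCat.of (RZExtension q)ᵐᵒᵖ k) hS ?_)
  refine le_iInf₂ fun n hn => absurd hn ?_
  refine (rzLoopData hq0 hq).not_isDeloopedAt (s := (1 : k)) one_ne_zero ?_ ?_ n
  · exact one_mul 1
  · exact zero_mul 1

end RZExtension

theorem mainTheorem2 {k : Type u} [Field k] (q : k) (hq0 : q ≠ 0)
    (hq : ∀ n : ℕ, 0 < n → q ^ n ≠ 1) :
    Module.Finite k (OnePointExtension k (RZAlgebra q) (RZModule q q)) ∧
      dell (OnePointExtension k (RZAlgebra q) (RZModule q q)) = ⊤ := by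
  have : Module.Finite k (RZModule q q) := inferInstanceAs (Module.Finite k (Fin 3 → k))
  exact ⟨inferInstance, dell_rzExtension hq0 hq⟩
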